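/- **Theorem 5.13 (Ideal Eklof Lemma).** Let $(\mathcal{A};\mathcal{E})$ be an exact category: $\mathcal{A}$ is an additive category and $\mathcal{E}$ is an isomorphism-closed class of kernel-cokernel pairs $X\xrightarrow{i}B\xrightarrow{p}C$ (*conflations*; $i$ is an *inflation*, $p$ a *deflation*) such that identities are inflations and deflations, inflations and deflations are closed under composition, and pushouts of inflations (pullbacks of deflations) along arbitrary morphisms exist and are inflations (deflations). Let $\operatorname{Ext}(C,X)$ be the isomorphism classes of conflations $X\to B\to C$, where a conflation represents $0$ if it is trivial, i.e. $i$ has a retraction. For $g:Y\to C$ and $f:X\to Z$ the map $\operatorname{Ext}(g,f):\operatorname{Ext}(C,X)\to\operatorname{Ext}(Y,Z)$ takes the pullback along $g$ followed by the pushout along $f$. An *ideal* of $\mathcal{A}$ is a class of morphisms $\mathcal{J}$ such that each $\mathcal{J}(X,Y)$ is a subgroup of $\operatorname{Hom}(X,Y)$ and $hgf\in\mathcal{J}$ whenever $g\in\mathcal{J}$ and $f,h$ are morphisms with $hgf$ defined. For a class of morphisms $\mathcal{M}$, let ${}^{\perp}\mathcal{M}$ be the class of morphisms $g$ with $\operatorname{Ext}(g,m)=0$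 for all $m\in\mathcal{M}$; an object $C$ belongs to a class of morphisms $\mathcal{I}$, written $C\in\operatorname{Ob}(\mathcal{I})$, if $1_C\in\mathcal{I}$. Let $\lambda$ be an ordinal. A *continuous $(\lambda+1)$-system* is a functor $\alpha\mapsto A_\alpha$, with structural morphisms $a^{\alpha}_{\beta}:A_\alpha\to A_\beta$, from the ordered set of ordinals $\alpha\le\lambda$ to $\mathcal{A}$, such that $A_\beta$, with the morphisms $a^\alpha_\beta$, is the colimit $\varinjlim_{\alpha<\beta}A_\alpha$ for every limit ordinal $\beta\le\lambda$. For an ideal $\mathcal{J}$, the *$\lambda$-th inductive power* $\mathcal{J}^{(\lambda)}$ is the ideal generated by all morphisms $a^0_\lambda:A_0\to A_\lambda$ coming from continuous $(\lambda+1)$-systems with $a^{\alpha}_{\alpha+1}\in\mathcal{J}$ for all $\alpha<\lambda$. An object $C$ *has a $\lambda$-filtration in* a class $\mathcal{C}$ of objects if there is a continuous $(\lambda+1)$-system $(C_\alpha)_{\alpha\le\lambda}$ with $C_0=0$ and $C_\lambda\cong C$ such that, for every $\alpha<\lambda$, the structural morphism $C_\alpha\to C_{\alpha+1}$ is an inflation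 whose cokernel $C_{\alpha+1}/C_\alpha$ lies in $\mathcal{C}$. Let $\mathcal{J}$ be an ideal of $\mathcal{A}$ and $\lambda$ an ordinal. If an object $C$ of $\mathcal{A}$ has a $\lambda$-filtration in $\operatorname{Ob}({}^{\perp}\mathcal{J})$, then $C\in\operatorname{Ob}\bigl({}^{\perp}(\mathcal{J}^{(\lambda)})\bigr)$; that is, $\operatorname{Ext}(1_C,j)=0$ for every $j\in\mathcal{J}^{(\lambda)}$. -/

import Mathlib

universe w v u

open CategoryTheory CategoryTheory.Limits

namespace IdealEklof

section Ideals

variable {A : Type u} [Category.{v} A] [Preadditive A]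

/-- A class of morphisms `J` is an ideal if it is an additive subfunctor of `Hom`: each `J(X, Y)` is
a subgroup of `Hom(X, Y)`, and `J` is closed under composition on both sides with arbitrary
morphisms. -/
structure IsIdeal (J : MorphismProperty A) : Prop where
  zero_mem : ∀ X Y : A, J (0 : X ⟶ Y)
  sub_mem : ∀ {X Y : A} (f g : X ⟶ Y), J f → J g → J (f - g)
  comp_mem : ∀ {W X Y Z : A} (f : W ⟶ X) (g : X ⟶ Y) (h : Y ⟶ Z), J g → J (f ≫ g ≫ h)

/-- The ideal generated by a class of morphisms: the smallest ideal containing it. -/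
def idealGenerated (W : MorphismProperty A) : MorphismProperty A :=
  fun _ _ f => ∀ I : MorphismProperty A, IsIdeal I → W ≤ I → I f

theorem isIdeal_idealGenerated (W : MorphismProperty A) : IsIdeal (idealGenerated W) where
  zero_mem X Y _ hI _ := hI.zero_mem X Y
  sub_mem f g hf hg I hI hW := hI.sub_mem f g (hf I hI hW) (hg I hI hW)
  comp_mem f g h hg I hI hW := hI.comp_mem f g h (hg I hI hW)

theorem le_idealGenerated (W : MorphismProperty A) : W ≤ idealGenerated W :=
  fun _ _ f hf _ _ hW => hW f hf

/-- `Ob(I)`: the objects whose identity morphism belongs to `I`. -/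
def objectsOf (I : MorphismProperty A) : ObjectProperty A := fun X => I (𝟙 X)

end Ideals

section Systems

variable {A : Type u} [Category.{v} A]

/-- The structural morphism `a^α_{α+1}` of a `(lam + 1)`-system, for `α < lam`.
A `(lam + 1)`-system is a functor on the ordinals `≤ lam`. -/
def succMap {lam : Ordinal.{w}} (F : Set.Iic lam ⥤ A) (α : Ordinal.{w}) (hα : α < lam) :
    F.obj ⟨α, hα.le⟩ ⟶ F.obj ⟨Order.succ α, Order.succ_le_of_lt hα⟩ :=
  F.map (homOfLE (Subtype.mk_le_mk.2 (Order.le_succ α)))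

/-- The composition morphism `a^0_lam` of a `(lam + 1)`-system. -/
def compositionMap {lam : Ordinal.{w}} (F : Set.Iic lam ⥤ A) :
    F.obj ⟨0, Set.mem_Iic.2 zero_le⟩ ⟶ F.obj ⟨lam, Set.mem_Iic.2 le_rfl⟩ :=
  F.map (homOfLE (Subtype.mk_le_mk.2 zero_le))

/-- The `lam`-compositions of morphisms in `J`: the composition morphisms of the `(lam + 1)`-systems
that are continuous (at every limit ordinal `β ≤ lam`, including `lam`) and all of whose structural
morphisms `a^α_{α+1}`, `α < lam`, belong to `J`. -/
inductive IsLambdaComposition (J : MorphismProperty A) (lam : Ordinal.{w}) : MorphismProperty A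
  | mk (F : Set.Iic lam ⥤ A) (hF : F.IsWellOrderContinuous)
      (hJ : ∀ (α : Ordinal.{w}) (hα : α < lam), J (succMap F α hα)) :
      IsLambdaComposition J lam (compositionMap F)

/-- The `lam`-th inductive power `J^(lam)`: the ideal generated by the `lam`-compositions of
morphisms in `J`. -/
def inductivePower [Preadditive A] (J : MorphismProperty A) (lam : Ordinal.{w}) :
    MorphismProperty A :=
  idealGenerated (IsLambdaComposition J lam)

end Systems

section Exact

variable {A : Type u} [Category.{v} A] [Preadditive A]

/-- The morphisms `i` occurring in a pair `(i, p)` of the class `S`. -/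
def inflations (S : ObjectProperty (ShortComplex A)) : MorphismProperty A :=
  fun _ Y i => ∃ (Z : A) (p : Y ⟶ Z) (zero : i ≫ p = 0), S (ShortComplex.mk i p zero)

/-- The morphisms `p` occurring in a pair `(i, p)` of the class `S`. -/
def deflations (S : ObjectProperty (ShortComplex A)) : MorphismProperty A :=
  fun Y _ p => ∃ (X : A) (i : X ⟶ Y) (zero : i ≫ p = 0), S (ShortComplex.mk i p zero)

variable (A) in
/-- An exact structure (in the sense of Quillen) on an additive category: an isomorphism-closed
class of kernel-cokernel pairs such that identities are inflations and deflations, inflations and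
deflations are closed under composition, pushouts of inflations along arbitrary morphisms exist and
are inflations, and pullbacks of deflations along arbitrary morphisms exist and are deflations. -/
structure ExactStructure where
  mem : ObjectProperty (ShortComplex A)
  mem_of_iso : ∀ {S T : ShortComplex A}, (S ≅ T) → mem S → mem T
  isKernel : ∀ S : ShortComplex A, mem S → Nonempty (IsLimit (KernelFork.ofι S.f S.zero))
  isCokernel : ∀ S : ShortComplex A, mem S → Nonempty (IsColimit (CokernelCofork.ofπ S.g S.zero))
  id_inflation : ∀ X : A, inflations mem (𝟙 X)
  id_deflation : ∀ X : A, deflations mem (𝟙 X)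
  comp_inflation : ∀ {X Y Z : A} (i : X ⟶ Y) (j : Y ⟶ Z),
    inflations mem i → inflations mem j → inflations mem (i ≫ j)
  comp_deflation : ∀ {X Y Z : A} (p : X ⟶ Y) (q : Y ⟶ Z),
    deflations mem p → deflations mem q → deflations mem (p ≫ q)
  pushout_inflation : ∀ {X Y X' : A} (i : X ⟶ Y) (f : X ⟶ X'), inflations mem i →
    ∃ (Y' : A) (f' : Y ⟶ Y') (i' : X' ⟶ Y'), IsPushout i f f' i' ∧ inflations mem i'
  pullback_deflation : ∀ {Y Z Z' : A} (p : Y ⟶ Z) (g : Z' ⟶ Z), deflations mem p →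
    ∃ (Y' : A) (g' : Y' ⟶ Y) (p' : Y' ⟶ Z'), IsPullback g' p' p g ∧ deflations mem p'

namespace ExactStructure

variable (E : ExactStructure A)

/-- A conflation `X → B → C` with prescribed end terms. It represents an element of `Ext(C, X)`. -/
structure Conflation (C X : A) where
  B : A
  i : X ⟶ B
  p : B ⟶ C
  zero : i ≫ p = 0
  mem : E.mem (ShortComplex.mk i p zero)

variable {E}

namespace Conflation

/-- A conflation is trivial, i.e. represents `0` in `Ext(C, X)`, if `i` has a retraction. -/
def IsTrivial {C X : A} (ξ : E.Conflation C X) : Prop := ∃ r : ξ.B ⟶ X, ξ.i ≫ r = 𝟙 X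

/-- `ξ'` is a pullback of `ξ` along `g`, i.e. it represents `Ext(g, X)(ξ)`. -/
def IsPullbackAlong {C Y X : A} (g : Y ⟶ C) (ξ : E.Conflation C X) (ξ' : E.Conflation Y X) :
    Prop :=
  ∃ b : ξ'.B ⟶ ξ.B, ξ'.i ≫ b = ξ.i ∧ IsPullback b ξ'.p ξ.p g

/-- `ξ'` is a pushout of `ξ` along `f`, i.e. it represents `Ext(C, f)(ξ)`. -/
def IsPushoutAlong {C X Z : A} (f : X ⟶ Z) (ξ : E.Conflation C X) (ξ' : E.Conflation C Z) :
    Prop :=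
  ∃ b : ξ.B ⟶ ξ'.B, b ≫ ξ'.p = ξ.p ∧ IsPushout ξ.i f b ξ'.i

theorem exists_isPushoutAlong {C X Z : A} (f : X ⟶ Z) (ξ : E.Conflation C X) :
    ∃ ξ' : E.Conflation C Z, IsPushoutAlong f ξ ξ' := by
  obtain ⟨B', b, i', hpo, Q, q, hq, hmem⟩ :=
    E.pushout_inflation ξ.i f ⟨_, ξ.p, ξ.zero, ξ.mem⟩
  obtain ⟨hp⟩ := E.isCokernel _ ξ.mem
  obtain ⟨hc⟩ := E.isCokernel _ hmem
  have w0 : ξ.i ≫ ξ.p = f ≫ (0 : Z ⟶ C) := by rw [ξ.zero, comp_zero]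
  have z1 : i' ≫ hpo.desc ξ.p 0 w0 = 0 := hpo.inr_desc _ _ _
  have z2 : ξ.i ≫ b ≫ q = 0 := by rw [← Category.assoc, hpo.w, Category.assoc, hq, comp_zero]
  obtain ⟨u, hu⟩ : ∃ u : Q ⟶ C, q ≫ u = hpo.desc ξ.p 0 w0 :=
    ⟨_, (CokernelCofork.IsColimit.desc' hc _ z1).2⟩
  obtain ⟨t, ht⟩ : ∃ t : C ⟶ Q, ξ.p ≫ t = b ≫ q :=
    ⟨_, (CokernelCofork.IsColimit.desc' hp _ z2).2⟩
  have key : hpo.desc ξ.p 0 w0 ≫ t = q := by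
    apply hpo.hom_ext
    · rw [← Category.assoc, hpo.inl_desc, ht]
    · rw [← Category.assoc, hpo.inr_desc, zero_comp, hq]
  have hut : u ≫ t = 𝟙 Q := by
    apply Cofork.IsColimit.hom_ext hc
    change q ≫ u ≫ t = q ≫ 𝟙 Q
    rw [← Category.assoc, hu, key, Category.comp_id]
  have htu : t ≫ u = 𝟙 C := by
    apply Cofork.IsColimit.hom_ext hp
    change ξ.p ≫ t ≫ u = ξ.p ≫ 𝟙 C
    rw [← Category.assoc, ht, Category.assoc, hu, hpo.inl_desc, Category.comp_id]
  refine ⟨⟨B', i', hpo.desc ξ.p 0 w0, z1, E.mem_of_iso ?_ hmem⟩, b, hpo.inl_desc _ _ _, hpo⟩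
  exact ShortComplex.isoMk (Iso.refl _) (Iso.refl _) ⟨u, t, hut, htu⟩ (by simp) (by simp [hu])

theorem exists_isPullbackAlong {C Y X : A} (g : Y ⟶ C) (ξ : E.Conflation C X) :
    ∃ ξ' : E.Conflation Y X, IsPullbackAlong g ξ ξ' := by
  obtain ⟨B', b, p', hpb, K, k, hk, hmem⟩ :=
    E.pullback_deflation ξ.p g ⟨_, ξ.i, ξ.zero, ξ.mem⟩
  obtain ⟨hi⟩ := E.isKernel _ ξ.mem
  obtain ⟨hc⟩ := E.isKernel _ hmem
  have w0 : ξ.i ≫ ξ.p = (0 : X ⟶ Y) ≫ g := by rw [ξ.zero, zero_comp]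
  have z1 : hpb.lift ξ.i 0 w0 ≫ p' = 0 := hpb.lift_snd _ _ _
  have z2 : (k ≫ b) ≫ ξ.p = 0 := by rw [Category.assoc, hpb.w, ← Category.assoc, hk, zero_comp]
  obtain ⟨u, hu⟩ : ∃ u : X ⟶ K, u ≫ k = hpb.lift ξ.i 0 w0 :=
    ⟨_, (KernelFork.IsLimit.lift' hc _ z1).2⟩
  obtain ⟨t, ht⟩ : ∃ t : K ⟶ X, t ≫ ξ.i = k ≫ b :=
    ⟨_, (KernelFork.IsLimit.lift' hi _ z2).2⟩
  have key : t ≫ hpb.lift ξ.i 0 w0 = k := by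
    apply hpb.hom_ext
    · rw [Category.assoc, hpb.lift_fst, ht]
    · rw [Category.assoc, hpb.lift_snd, comp_zero, hk]
  have htu : t ≫ u = 𝟙 K := by
    apply Fork.IsLimit.hom_ext hc
    change (t ≫ u) ≫ k = 𝟙 K ≫ k
    rw [Category.assoc, hu, key, Category.id_comp]
  have hut : u ≫ t = 𝟙 X := by
    apply Fork.IsLimit.hom_ext hi
    change (u ≫ t) ≫ ξ.i = 𝟙 X ≫ ξ.i
    rw [Category.assoc, ht, ← Category.assoc, hu, hpb.lift_fst, Category.id_comp]
  refine ⟨⟨B', hpb.lift ξ.i 0 w0, p', z1, E.mem_of_iso ?_ hmem⟩, b, hpb.lift_fst _ _ _, hpb⟩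
  exact ShortComplex.isoMk ⟨t, u, htu, hut⟩ (Iso.refl _) (Iso.refl _) (by simp [key]) (by simp)

end Conflation

variable (E)

/-- `Ext(g, f) = 0` as a map `Ext(C, X) → Ext(Y, Z)`, for `g : Y ⟶ C` and `f : X ⟶ Z`. The class of
a conflation `ξ` is sent to the class of the pushout along `f` of the pullback of `ξ` along `g`
(these exist and are unique up to isomorphism), and a class is `0` when its conflations are
trivial. -/
def ExtMapEqZero {Y C X Z : A} (g : Y ⟶ C) (f : X ⟶ Z) : Prop :=
  ∀ (ξ : E.Conflation C X) (ξ' : E.Conflation Y X) (ξ'' : E.Conflation Y Z),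
    ξ.IsPullbackAlong g ξ' → ξ'.IsPushoutAlong f ξ'' → ξ''.IsTrivial

/-- The left perpendicular class `⊥M`: the morphisms `g` with `Ext(g, m) = 0` for all `m` in `M`. -/
def leftPerp (M : MorphismProperty A) : MorphismProperty A :=
  fun _ _ g => ∀ ⦃X Z : A⦄ (m : X ⟶ Z), M m → E.ExtMapEqZero g m

/-- `C` has a `lam`-filtration in the class of objects `P`: there is a continuous `(lam + 1)`-system
starting at a zero object and ending at `C`, whose successive structural morphisms are inflations
with cokernels in `P`. -/
def HasFiltration (P : ObjectProperty A) (lam : Ordinal.{w}) (C : A) : Prop :=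
  ∃ F : Set.Iic lam ⥤ A, F.IsWellOrderContinuous ∧
    IsZero (F.obj ⟨0, Set.mem_Iic.2 zero_le⟩) ∧
    Nonempty (F.obj ⟨lam, Set.mem_Iic.2 le_rfl⟩ ≅ C) ∧
    ∀ (α : Ordinal.{w}) (hα : α < lam),
      ∃ (Q : A) (q : F.obj ⟨Order.succ α, Order.succ_le_of_lt hα⟩ ⟶ Q)
        (zero : succMap F α hα ≫ q = 0),
        E.mem (ShortComplex.mk (succMap F α hα) q zero) ∧ P Q

end ExactStructure

end Exact

end IdealEklof

/-! The morphisms `j` with `Ext(1_C, j) = 0` form an ideal (`isIdeal_extMapEqZero`), so only the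
composition maps `a^0_lam` need be treated. Given a conflation `ξ` of `C` by `A_0`, let `ζ α` be its
pushout along `a^0_α`. The pushout `ζ lam` splits as soon as its deflation has a section, and such a
section is built along the filtration: compatible lifts `C_α ⟶ (ζ α).B` of the maps `C_α ⟶ C` are
chosen by transfinite recursion. At limits they glue, because `C_β` is a colimit. The successor step
`exists_lift_extension` carries the proof. A lift over `C_α` splits the part of the pulled back
conflation lying over `C_α`. The resulting projection to `A_α`, followed by `A_α ⟶ A_{α+1}` in `J`,
extends over `C_{α+1}` because the cokernel `C_{α+1}/C_α` is in `Ob(⊥J)`. Subtracting this extension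
yields the next lift. Each successor thus uses up one factor from `J`. -/

namespace IdealEklof

section Recursion

/-- Transfinite construction of a dependent family satisfying at each `a` a condition on the value at
`a` and the previous values, when every partial solution can be extended. -/
theorem exists_forall_of_extension {ι : Type*} [Preorder ι] [WellFoundedLT ι] (X : ι → Type*)
    [∀ a, Nonempty (X a)] (P : ∀ a, (∀ b, b < a → X b) → X a → Prop)
    (step : ∀ (a : ι) (f : ∀ b, b < a → X b),
      (∀ (b : ι) (hb : b < a), P b (fun c hc => f c (hc.trans hb)) (f b hb)) → ∃ x, P a f x) :
    ∃ f : ∀ a, X a, ∀ a, P a (fun b _ => f b) (f a) := by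
  classical
  -- The arbitrary value only makes `G` total; the induction below shows that it is never taken.
  let G : ∀ a, (∀ b, b < a → X b) → X a := fun a f =>
    if h : ∃ x, P a f x then h.choose else Classical.arbitrary _
  let f : ∀ a, X a := wellFounded_lt.fix G
  have hf : ∀ a, f a = G a (fun b _ => f b) := fun a => wellFounded_lt.fix_eq G a
  refine ⟨f, fun a => ?_⟩
  induction a using wellFounded_lt.induction (α := ι) with
  | _ a ih =>
    have h : ∃ x, P a (fun b _ => f b) x := step a _ fun b hb => ih b hb
    rw [hf a]
    simp only [G, dif_pos h]
    exact h.choose_spec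

end Recursion

section Ideals

variable {A : Type u} [Category.{v} A] [Preadditive A] {J : MorphismProperty A}

theorem IsIdeal.precomp (hJ : IsIdeal J) {W X Y : A} (f : W ⟶ X) {g : X ⟶ Y} (hg : J g) :
    J (f ≫ g) := by
  simpa using hJ.comp_mem f g (𝟙 Y) hg

end Ideals

/-! ### Universal property of the terms at limit ordinals. -/

section Continuity

variable {A : Type u} [Category.{v} A] {ι : Type*} [LinearOrder ι] (F : ι ⥤ A)
  [F.IsWellOrderContinuous] {β : ι}

theorem hom_ext_of_isSuccLimit (hβ : Order.IsSuccLimit β) {X : A} {g h : F.obj β ⟶ X}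
    (w : ∀ (γ : ι) (hγ : γ < β), F.map (homOfLE hγ.le) ≫ g = F.map (homOfLE hγ.le) ≫ h) :
    g = h :=
  (F.isColimitOfIsWellOrderContinuous β hβ).hom_ext fun γ => w γ.1 γ.2

theorem exists_desc_of_isSuccLimit (hβ : Order.IsSuccLimit β) {X : A}
    (f : ∀ γ : ι, γ < β → (F.obj γ ⟶ X))
    (hf : ∀ (γ δ : ι) (h : γ ≤ δ) (hδ : δ < β),
      F.map (homOfLE h) ≫ f δ hδ = f γ (h.trans_lt hδ)) :
    ∃ g : F.obj β ⟶ X, ∀ (γ : ι) (hγ : γ < β), F.map (homOfLE hγ.le) ≫ g = f γ hγ := by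
  let c : Cocone ((Set.principalSegIio β).monotone.functor ⋙ F) :=
    { pt := X
      ι :=
        { app := fun γ => f γ.1 γ.2
          naturality := fun γ δ φ => by
            exact (hf γ.1 δ.1 (leOfHom φ) δ.2).trans (Category.comp_id _).symm } }
  exact ⟨(F.isColimitOfIsWellOrderContinuous β hβ).desc c, fun γ hγ =>
    (F.isColimitOfIsWellOrderContinuous β hβ).fac c ⟨γ, hγ⟩⟩

end Continuity

/-! ### Splitting and extension in exact categories. -/

namespace ExactStructure

variable {A : Type u} [Category.{v} A] [Preadditive A] {E : ExactStructure A}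

theorem exists_lift_of_mem {S : ShortComplex A} (hS : E.mem S) {X : A} (f : X ⟶ S.X₂)
    (hf : f ≫ S.g = 0) : ∃ l : X ⟶ S.X₁, l ≫ S.f = f := by
  obtain ⟨h⟩ := E.isKernel S hS
  exact ⟨_, (KernelFork.IsLimit.lift' h f hf).2⟩

theorem exists_desc_of_mem {S : ShortComplex A} (hS : E.mem S) {X : A} (f : S.X₂ ⟶ X)
    (hf : S.f ≫ f = 0) : ∃ l : S.X₃ ⟶ X, S.g ≫ l = f := by
  obtain ⟨h⟩ := E.isCokernel S hS
  exact ⟨_, (CokernelCofork.IsColimit.desc' h f hf).2⟩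

theorem mono_of_mem {S : ShortComplex A} (hS : E.mem S) : Mono S.f := by
  obtain ⟨h⟩ := E.isKernel S hS
  exact ⟨fun _ _ w => Fork.IsLimit.hom_ext h w⟩

theorem epi_of_mem {S : ShortComplex A} (hS : E.mem S) : Epi S.g := by
  obtain ⟨h⟩ := E.isCokernel S hS
  exact ⟨fun _ _ w => Cofork.IsColimit.hom_ext h w⟩

namespace Conflation

variable {C X : A}

theorem exists_lift (ξ : E.Conflation C X) {W : A} (f : W ⟶ ξ.B) (hf : f ≫ ξ.p = 0) :
    ∃ l : W ⟶ X, l ≫ ξ.i = f :=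
  exists_lift_of_mem ξ.mem f hf

theorem exists_desc (ξ : E.Conflation C X) {W : A} (f : ξ.B ⟶ W) (hf : ξ.i ≫ f = 0) :
    ∃ l : C ⟶ W, ξ.p ≫ l = f :=
  exists_desc_of_mem ξ.mem f hf

theorem mono_i (ξ : E.Conflation C X) : Mono ξ.i := mono_of_mem ξ.mem

theorem epi_p (ξ : E.Conflation C X) : Epi ξ.p := epi_of_mem ξ.mem

/-- A section of the deflation of a conflation provides a retraction of the inflation. -/
theorem isTrivial_of_section (ξ : E.Conflation C X) (s : C ⟶ ξ.B) (hs : s ≫ ξ.p = 𝟙 C) :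
    ξ.IsTrivial := by
  -- The idempotent complementary to `ξ.p ≫ s` is killed by `ξ.p`, so it factors through `ξ.i`.
  obtain ⟨r, hr⟩ := ξ.exists_lift (𝟙 ξ.B - ξ.p ≫ s) (by simp [hs])
  have := ξ.mono_i
  refine ⟨r, ?_⟩
  rw [← cancel_mono ξ.i, Category.assoc, hr]
  simp [reassoc_of% ξ.zero]

/-- The pushout of a conflation along `f` is trivial if and only if `f` extends along the
inflation. -/
theorem IsPushoutAlong.isTrivial_iff {Z : A} {f : X ⟶ Z} {ξ : E.Conflation C X}
    {ζ : E.Conflation C Z} (h : IsPushoutAlong f ξ ζ) :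
    ζ.IsTrivial ↔ ∃ e : ξ.B ⟶ Z, ξ.i ≫ e = f := by
  obtain ⟨b, -, hb⟩ := h
  constructor
  · rintro ⟨r, hr⟩
    exact ⟨b ≫ r, by rw [← Category.assoc, hb.w, Category.assoc, hr, Category.comp_id]⟩
  · rintro ⟨e, he⟩
    exact ⟨hb.desc e (𝟙 Z) (by simpa using he), hb.inr_desc _ _ _⟩

theorem isPullbackAlong_id (ξ : E.Conflation C X) : IsPullbackAlong (𝟙 C) ξ ξ :=
  ⟨𝟙 _, by simp, IsPullback.of_horiz_isIso ⟨by simp⟩⟩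

end Conflation

/-- A conflation is its own pullback along the identity, and its pushout along `f` splits exactly
when `f` extends. All later work with `Ext` is done through these extension problems. -/
theorem extMapEqZero_id_iff {C X Z : A} (f : X ⟶ Z) :
    E.ExtMapEqZero (𝟙 C) f ↔ ∀ ξ : E.Conflation C X, ∃ e : ξ.B ⟶ Z, ξ.i ≫ e = f := by
  constructor
  · intro h ξ
    obtain ⟨ζ, hζ⟩ := ξ.exists_isPushoutAlong f
    exact hζ.isTrivial_iff.1 (h ξ ξ ζ ξ.isPullbackAlong_id hζ)
  · intro h _ ξ ζ _ hζ
    exact hζ.isTrivial_iff.2 (h ξ)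

/-- For a fixed object `C`, the morphisms `j` with `Ext(1_C, j) = 0` form an ideal. -/
theorem isIdeal_extMapEqZero (C : A) :
    IsIdeal (fun _ _ j => E.ExtMapEqZero (𝟙 C) j : MorphismProperty A) where
  zero_mem X Y := (extMapEqZero_id_iff _).2 fun _ => ⟨0, comp_zero⟩
  sub_mem f g hf hg := (extMapEqZero_id_iff _).2 fun ξ => by
    obtain ⟨d, hd⟩ := (extMapEqZero_id_iff _).1 hf ξ
    obtain ⟨e, he⟩ := (extMapEqZero_id_iff _).1 hg ξ
    exact ⟨d - e, by rw [Preadditive.comp_sub, hd, he]⟩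
  comp_mem f g h hg := (extMapEqZero_id_iff _).2 fun ξ => by
    obtain ⟨ζ, b, -, hb⟩ := ξ.exists_isPushoutAlong f
    obtain ⟨e, he⟩ := (extMapEqZero_id_iff _).1 hg ζ
    exact ⟨b ≫ e ≫ h, by rw [← he, reassoc_of% hb.w, Category.assoc]⟩

/-- If `𝟙 Q` is left perpendicular to `J`, then morphisms in `J` extend along every inflation with
cokernel `Q`. -/
theorem exists_extension_of_leftPerp {J : MorphismProperty A} {Q : A} (hQ : E.leftPerp J (𝟙 Q))
    {S : ShortComplex A} (hS : E.mem S) (e : S.X₃ = Q) {Z : A} (j : S.X₁ ⟶ Z) (hj : J j) :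
    ∃ h : S.X₂ ⟶ Z, S.f ≫ h = j := by
  subst e
  exact (extMapEqZero_id_iff j).1 (hQ j hj) ⟨S.X₂, S.f, S.g, S.zero, hS⟩

/-- Let `C' ⟶ C'' ⟶ Q` be a conflation with `𝟙 Q` left perpendicular to `J`, and let `ξ ⟶ ζ` be
a morphism of conflations ending at `C` that is given on the left by a morphism in `J`. A lift
`C' ⟶ ξ.B` of `C' ⟶ C'' ⟶ C` extends to a lift `C'' ⟶ ζ.B`. -/
theorem exists_lift_extension {J : MorphismProperty A} (hJ : IsIdeal J)
    {C' C'' Q C X Z : A} {κ : C' ⟶ C''} {q : C'' ⟶ Q} {zero : κ ≫ q = 0}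
    (hmem : E.mem (ShortComplex.mk κ q zero)) (hQ : E.leftPerp J (𝟙 Q)) (c : C'' ⟶ C)
    (ξ : E.Conflation C X) (ζ : E.Conflation C Z) (j : X ⟶ Z) (hj : J j)
    (b : ξ.B ⟶ ζ.B) (hb : ξ.i ≫ b = j ≫ ζ.i) (hbp : b ≫ ζ.p = ξ.p)
    (s : C' ⟶ ξ.B) (hs : s ≫ ξ.p = κ ≫ c) :
    ∃ t : C'' ⟶ ζ.B, t ≫ ζ.p = c ∧ κ ≫ t = s ≫ b := by
  obtain ⟨η, d, hd, hpb⟩ := ξ.exists_isPullbackAlong c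
  have := η.mono_i
  have := η.epi_p
  -- `K` is the part of `η.B` over `C'`. The lift `s` splits it: below, `iK` and `σK` exhibit `K` as
  -- `X ⊕ C'` with projections `r` and `l`.
  obtain ⟨K, k, zeroK, hK⟩ := E.comp_deflation η.p q ⟨_, _, _, η.mem⟩ ⟨_, _, _, hmem⟩
  have : Mono k := mono_of_mem hK
  obtain ⟨l, hl⟩ : ∃ l : K ⟶ C', l ≫ κ = k ≫ η.p :=
    exists_lift_of_mem hmem (k ≫ η.p) (by simpa using zeroK)
  obtain ⟨iK, hiK⟩ : ∃ iK : X ⟶ K, iK ≫ k = η.i :=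
    exists_lift_of_mem hK η.i (by simp [reassoc_of% η.zero])
  obtain ⟨σ, hσd, hσp⟩ : ∃ σ : C' ⟶ η.B, σ ≫ d = s ∧ σ ≫ η.p = κ :=
    ⟨hpb.lift s κ hs, hpb.lift_fst _ _ _, hpb.lift_snd _ _ _⟩
  obtain ⟨σK, hσK⟩ : ∃ σK : C' ⟶ K, σK ≫ k = σ :=
    exists_lift_of_mem hK σ (by simpa [reassoc_of% hσp] using zero)
  obtain ⟨r, hr⟩ := η.exists_lift (k - l ≫ σ) (by simp [hσp, hl])
  have : Mono κ := mono_of_mem hmem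
  have hiKl : iK ≫ l = 0 := by
    rw [← cancel_mono κ, Category.assoc, hl, reassoc_of% hiK, η.zero, zero_comp]
  have hσKl : σK ≫ l = 𝟙 _ := by
    rw [← cancel_mono κ, Category.assoc, hl, reassoc_of% hσK, hσp, Category.id_comp]
  have hiKr : iK ≫ r = 𝟙 _ := by
    rw [← cancel_mono η.i, Category.assoc, hr, Preadditive.comp_sub, hiK, reassoc_of% hiKl]
    simp
  have hσKr : σK ≫ r = 0 := by
    rw [← cancel_mono η.i, Category.assoc, hr, Preadditive.comp_sub, hσK, reassoc_of% hσKl]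
    simp
  -- The inflation `k` has cokernel `Q`. The extension `e` agrees with `j` on `X` and vanishes on
  -- `σ`.
  obtain ⟨e, he⟩ : ∃ e : η.B ⟶ Z, k ≫ e = r ≫ j :=
    exists_extension_of_leftPerp hQ hK rfl (r ≫ j) (hJ.precomp r hj)
  -- The correction `e ≫ ζ.i` cancels `d ≫ b` on `X` and changes neither its image in `C` nor its
  -- values on `C'`.
  obtain ⟨t, ht⟩ := η.exists_desc (d ≫ b - e ≫ ζ.i) (by
    rw [Preadditive.comp_sub, reassoc_of% hd, hb, ← reassoc_of% hiK, reassoc_of% he,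
      reassoc_of% hiKr, sub_self])
  refine ⟨t, ?_, ?_⟩
  · rw [← cancel_epi η.p, reassoc_of% ht]
    simp [hbp, ζ.zero, hpb.w]
  · rw [← hσp, Category.assoc, ht, Preadditive.comp_sub, reassoc_of% hσd, ← hσK,
      Category.assoc, reassoc_of% he, reassoc_of% hσKr, zero_comp, sub_zero]

/-- Along every inflation whose cokernel has a `lam`-filtration in `Ob(⊥J)`, the composition
morphism of a `(lam + 1)`-system with successive structural morphisms in `J` extends. The proof
constructs by transfinite recursion compatible lifts of the terms of the filtration to the pushouts
of `ξ` along the morphisms `a^0_α`. -/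
theorem exists_extension_compositionMap {J : MorphismProperty A} (hJ : IsIdeal J)
    {lam : Ordinal.{w}} {C : A} (hC : E.HasFiltration (objectsOf (E.leftPerp J)) lam C)
    (G : Set.Iic lam ⥤ A) (hG : ∀ (α : Ordinal.{w}) (hα : α < lam), J (succMap G α hα))
    (ξ : E.Conflation C (G.obj ⟨0, Set.mem_Iic.2 zero_le⟩)) :
    ∃ e : ξ.B ⟶ G.obj ⟨lam, Set.mem_Iic.2 le_rfl⟩, ξ.i ≫ e = compositionMap G := by
  obtain ⟨F, hF, hF0, ⟨iso⟩, hsucc⟩ := hC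
  let o : Set.Iic lam := ⟨0, Set.mem_Iic.2 zero_le⟩
  let ω : Set.Iic lam := ⟨lam, Set.mem_Iic.2 le_rfl⟩
  have ho (α : Set.Iic lam) : o ≤ α := Subtype.mk_le_mk.2 zero_le
  have hω (α : Set.Iic lam) : α ≤ ω := α.2
  choose ζ b hbp hpo using fun α : Set.Iic lam =>
    ξ.exists_isPushoutAlong (G.map (homOfLE (ho α)))
  -- The pushouts are chosen independently; uniqueness of maps out of them makes the `m` functorial.
  have htrans (α β : Set.Iic lam) (h : α ≤ β) : ∃ m : (ζ α).B ⟶ (ζ β).B,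
      b α ≫ m = b β ∧ (ζ α).i ≫ m = G.map (homOfLE h) ≫ (ζ β).i := by
    refine ⟨(hpo α).desc (b β) (G.map (homOfLE h) ≫ (ζ β).i) ?_,
      (hpo α).inl_desc _ _ _, (hpo α).inr_desc _ _ _⟩
    rw [(hpo β).w, ← Category.assoc, ← G.map_comp]
    rfl
  choose m hbm him using htrans
  have hmp (α β : Set.Iic lam) (h : α ≤ β) : m α β h ≫ (ζ β).p = (ζ α).p := by
    apply (hpo α).hom_ext
    · rw [reassoc_of% hbm, hbp, hbp]
    · rw [reassoc_of% him, (ζ β).zero, (ζ α).zero, comp_zero]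
  have hmm (α β γ : Set.Iic lam) (h : α ≤ β) (h' : β ≤ γ) :
      m α β h ≫ m β γ h' = m α γ (h.trans h') := by
    apply (hpo α).hom_ext
    · rw [reassoc_of% hbm, hbm, hbm]
    · rw [reassoc_of% him, him, him, ← Category.assoc, ← G.map_comp]
      rfl
  let c (α : Set.Iic lam) : F.obj α ⟶ C := F.map (homOfLE (hω α)) ≫ iso.hom
  have hc (α β : Set.Iic lam) (h : α ≤ β) : F.map (homOfLE h) ≫ c β = c α := by
    simp only [c, ← Category.assoc, ← F.map_comp]
    rfl
  obtain ⟨s, hs⟩ := exists_forall_of_extension (fun α => F.obj α ⟶ (ζ α).B)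
    (fun α f x => x ≫ (ζ α).p = c α ∧
      ∀ (γ : Set.Iic lam) (h : γ < α), F.map (homOfLE h.le) ≫ x = f γ h ≫ m γ α h.le) (by
    intro β f hf
    have hf1 (γ : Set.Iic lam) (h : γ < β) : f γ h ≫ (ζ γ).p = c γ := (hf γ h).1
    have hf2 (γ δ : Set.Iic lam) (h : γ ≤ δ) (h' : δ < β) :
        F.map (homOfLE h) ≫ f δ h' = f γ (h.trans_lt h') ≫ m γ δ h := by
      rcases h.lt_or_eq with h | rfl
      · exact (hf δ h').2 γ h
      · have e : m γ γ le_rfl = 𝟙 _ := by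
          apply (hpo γ).hom_ext
          · rw [hbm, Category.comp_id]
          · rw [him]
            simp
        rw [e]
        simp
    obtain ⟨β, hβ⟩ := β
    rcases Ordinal.zero_or_succ_or_isSuccLimit β with rfl | ⟨α, rfl⟩ | hlim
    -- The filtration starts at a zero object, so the zero map is a lift.
    · exact ⟨0, hF0.eq_of_src _ _, fun γ h => absurd h (ho γ).not_gt⟩
    · have hα : α < lam := Order.succ_le_iff.1 hβ
      obtain ⟨Q, q, zero, hmem, hQ⟩ := hsucc α hα
      let a : Set.Iic lam := ⟨α, hα.le⟩
      let a' : Set.Iic lam := ⟨Order.succ α, hβ⟩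
      have ha : a < a' := Order.lt_succ α
      obtain ⟨t, ht1, ht2⟩ := exists_lift_extension hJ hmem hQ (c a') (ζ a) (ζ a')
        (succMap G α hα) (hG α hα) (m a a' ha.le) (him a a' ha.le) (hmp a a' ha.le) (f a ha)
        ((hf1 a ha).trans (hc a a' ha.le).symm)
      refine ⟨t, ht1, fun γ h => ?_⟩
      have hγ : γ ≤ a := Order.lt_succ_iff (a := γ.1).1 h
      have e1 : F.map (homOfLE h.le) = F.map (homOfLE hγ) ≫ succMap F α hα := by
        rw [succMap, ← F.map_comp]
        rfl
      rw [e1, Category.assoc, ht2, reassoc_of% hf2 γ a hγ ha, hmm]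
    · have hlim' : Order.IsSuccLimit (⟨β, hβ⟩ : Set.Iic lam) := by
        refine ⟨fun hmin => hlim.ne_zero (nonpos_iff_eq_zero.1 (hmin (ho _))), fun γ hγ => ?_⟩
        have hγ' := Order.IsSuccLimit.succ_lt hlim (Subtype.mk_lt_mk.1 hγ.lt)
        exact hγ.2 (c := ⟨Order.succ γ.1, hγ'.le.trans hβ⟩) (Order.lt_succ γ.1) hγ'
      obtain ⟨t, ht⟩ := exists_desc_of_isSuccLimit F hlim' (fun γ h => f γ h ≫ m γ _ h.le)
        (fun γ δ h hδ => by rw [reassoc_of% hf2 γ δ h hδ, hmm])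
      -- That the glued map lifts `c` can be tested on the earlier terms of the filtration.
      refine ⟨t, hom_ext_of_isSuccLimit F hlim' fun γ hγ => ?_, ht⟩
      rw [reassoc_of% ht γ hγ, hmp, hf1, hc])
  obtain ⟨r, hr⟩ := (ζ ω).isTrivial_of_section (iso.inv ≫ s ω) (by
    rw [Category.assoc, (hs ω).1, Iso.inv_comp_eq]
    simp [c])
  exact ⟨b ω ≫ r, by rw [reassoc_of% (hpo ω).w, hr, Category.comp_id]; rfl⟩

end ExactStructure

end IdealEklof

theorem theorem5p13 {A : Type u} [Category.{v} A] [Preadditive A] [HasFiniteBiproducts A]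
    (E : IdealEklof.ExactStructure A)
    (J : MorphismProperty A) (hJ : IdealEklof.IsIdeal J)
    (lam : Ordinal.{w}) (C : A)
    (hC : E.HasFiltration (IdealEklof.objectsOf (E.leftPerp J)) lam C) :
    IdealEklof.objectsOf (E.leftPerp (IdealEklof.inductivePower J lam)) C := by
  intro X Z j hj
  -- `hj` places `j` in every ideal containing the compositions, so it suffices to check these.
  refine hj _ (IdealEklof.ExactStructure.isIdeal_extMapEqZero C) ?_
  rintro _ _ _ ⟨G, -, hG⟩
  exact (IdealEklof.ExactStructure.extMapEqZero_id_iff _).2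
    (IdealEklof.ExactStructure.exists_extension_compositionMap hJ hC G hG)
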